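/- Let $G$ be a finite abelian group, $G^+=G\setminus\{0\}$, and $g_0\in G$. The master corner polyhedron $P(G,g_0)\subset\mathbb{R}^{G^+}$ is the convex hull of all nonzero points $t=(t(g))_{g\in G^+}$ with nonnegative integer coordinates such that $\sum_{g\in G^+}t(g)\,g=g_0$ (the condition $t\neq 0$ matters only if $g_0=0$). For such an integer point $t$ put $G_t=\{g\in G^+ : t(g)>0\}$ and define two operations. (a) Let $h,f\in G_t$ be distinct elements with $h+f\in G^+$, named so that $t(h)\le t(f)$. Then $\mu_{h,f}$ is applicable to $t$, and $s=\mu_{h,f}(t)$ is the point with $s(h)=0$, $s(f)=t(f)-t(h)$, $s(h+f)=t(h+f)+t(h)$, and $s(g)=t(g)$ for all other $g\in G^+$. (b) Let $h\in G_t$ with $t(h)>1$ and $t(h)h\in G^+$. Then $\mu_h$ is applicable to $t$, and $s=\mu_h(t)$ is the point with $s(h)=0$, $s(t(h)h)=t(t(h)h)+1$, and $s(g)=t(g)$ for all other $g\in G^+$. (If $t$ is a vertex of $P(G,g_0)$, then $t(h)h\ne h$, so this is unambiguous.) Theorem. Let $t$ be a vertex of $P(G,g_0)$ (vertices are always integer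 points). If $\mu_{h,f}$ is applicable to $t$, then $\mu_{h,f}(t)$ is a vertex of $P(G,g_0)$ adjacent to $t$; if $\mu_h$ is applicable to $t$, then $\mu_h(t)$ is a vertex of $P(G,g_0)$ adjacent to $t$. Here two distinct vertices of $P(G,g_0)$ are adjacent if the segment joining them is a one-dimensional face (an edge) of $P(G,g_0)$. -/

import Mathlib

namespace MasterCorner

/-- `G⁺`, the set of nonzero elements of the group `G`. It indexes the coordinates. -/
abbrev GPlus (G : Type*) [AddCommGroup G] : Type _ := {g : G // g ≠ 0}

section

variable {G : Type*} [AddCommGroup G]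

/-- A nonnegative integer point, seen as a point of the real space with coordinates in `G⁺`. -/
def toReal (t : GPlus G → ℕ) : GPlus G → ℝ := fun g => (t g : ℝ)

/-- The nonnegative integer solutions `t` of the group equation `∑ t(g) g = g₀`. The zero point,
which solves the equation only if `g₀ = 0`, is not counted as a solution. -/
def solutions [Fintype G] [DecidableEq G] (g₀ : G) : Set (GPlus G → ℕ) :=
  {t | t ≠ 0 ∧ ∑ g, t g • (g : G) = g₀}

/-- The master corner polyhedron `P(G, g₀)`. -/
def polyhedron [Fintype G] [DecidableEq G] (g₀ : G) : Set (GPlus G → ℝ) :=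
  convexHull ℝ (toReal '' solutions g₀)

/-- Two points of `P` are adjacent vertices: they are distinct vertices, and the segment between
them is a face (an edge) of `P`, cut out of `P` by a supporting hyperplane. -/
def Adjacent {ι : Type*} (P : Set (ι → ℝ)) (x y : ι → ℝ) : Prop :=
  x ∈ P.extremePoints ℝ ∧ y ∈ P.extremePoints ℝ ∧ x ≠ y ∧ IsExposed ℝ P (segment ℝ x y)

/-- The operation `μ_{h,f}` is applicable to the integer point `t`: `h` and `f` are different
elements of `G_t = {g ∈ G⁺ | t(g) > 0}`, named so that `t(h) ≤ t(f)`, and `h + f` indexes a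
coordinate, i.e. `h + f ∈ G⁺`. -/
def MuPairApplies (t : GPlus G → ℕ) (h f : GPlus G) : Prop :=
  0 < t h ∧ 0 < t f ∧ h ≠ f ∧ t h ≤ t f ∧ (h : G) + f ≠ 0

/-- The point `μ_{h,f}(t)`. -/
def muPair [DecidableEq G] (h f : GPlus G) (t : GPlus G → ℕ) : GPlus G → ℕ := fun g =>
  if g = h then 0
  else if g = f then t f - t h
  else if (g : G) = h + f then t g + t h
  else t g

/-- The operation `μ_h` is applicable to the integer point `t`: `t(h) > 1`, and `t(h) h` indexes a
coordinate, i.e. `t(h) h ∈ G⁺`. -/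
def MuSingleApplies (t : GPlus G → ℕ) (h : GPlus G) : Prop :=
  1 < t h ∧ t h • (h : G) ≠ 0

/-- The point `μ_h(t)`. -/
def muSingle [DecidableEq G] (h : GPlus G) (t : GPlus G → ℕ) : GPlus G → ℕ := fun g =>
  if g = h then 0
  else if (g : G) = t h • (h : G) then t g + 1
  else t g

end

end MasterCorner

/-!
The edge from a vertex `t` is found by undoing the operation linearly. Let `w` be the group element
that the operation puts into the solution and let `a` be the block it replaces: `a = e_h + e_f` and
`w = h + f` for `μ_{h,f}`, and `a = t(h) e_h` and `w = t(h) h` for `μ_h`. In both cases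
`∑ a(g) g = w`, and the operation takes `t` to `t - k a + k e_w` for some `k > 0`. The linear map
`φ x = x + x(w) (a - e_w)` expands every occurrence of `w` into the block `a`, so it maps solutions
to solutions and the polyhedron into itself. A vertex `t ≥ a` has `t(w) = 0`
(`apply_eq_zero_of_extreme`), since otherwise `t + a - e_w` and `t - a + e_w` would be solutions
with midpoint `t`. Hence `φ` sends `t` and its image under the operation to `t`, and the points of
the polyhedron which `φ` sends to `t` form the segment between the two. Composing `φ` with a
functional that exposes `t` exposes this segment (`adjacent_of_retraction`).

It remains to know that a vertex is an exposed point (`mem_exposedPoints_of_extreme`). By Dickson's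
lemma there are finitely many minimal solutions. The vertex `t` is not in the convex hull of the
minimal solutions other than `t` together with the points `t + |G| e_g`, so some functional is
smaller at `t` than at all of these. It is then positive on every `e_g`, and every
solution lies above a minimal one, so `t` is its only minimizer.
-/

namespace MasterCorner

/-! ### Convex geometry -/

section Convex

variable {E : Type*} [AddCommGroup E] [Module ℝ E]

theorem right_mem_extremePoints_segment {x y : E} (hxy : x ≠ y) :
    y ∈ (segment ℝ x y).extremePoints ℝ := by
  rw [mem_extremePoints_iff_left]
  refine ⟨right_mem_segment ℝ x y, ?_⟩
  intro u hu v hv hy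
  rw [segment_eq_image'] at hu hv
  obtain ⟨a, ⟨-, ha⟩, rfl⟩ := hu
  obtain ⟨b, ⟨-, hb⟩, rfl⟩ := hv
  obtain ⟨p, q, hp, hq, hpq, h⟩ := hy
  have h0 : (p * a + q * b - 1) • (y - x) = 0 := by
    have e : (p * a + q * b - 1) • (y - x) =
        (p • (x + a • (y - x)) + q • (x + b • (y - x))) - y + (1 - (p + q)) • x := by module
    rw [e, h, hpq]
    simp
  have h1 : p * a + q * b - 1 = 0 :=
    (smul_eq_zero.1 h0).resolve_right (sub_ne_zero.2 hxy.symm)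
  have ha1 : a = 1 := by nlinarith
  simp [ha1]

variable [TopologicalSpace E]

/-- A linear functional which is smaller at `t` than at all other points of `S` is smaller at `t`
than at all other points of the convex hull of `S`. -/
theorem lt_or_eq_of_mem_convexHull (l : StrongDual ℝ E) {S : Set E} {t : E}
    (h : ∀ x ∈ S, x ≠ t → l t < l x) {x : E} (hx : x ∈ convexHull ℝ S) : l t < l x ∨ x = t := by
  have hconv : Convex ℝ {x | l t < l x ∨ x = t} := by
    rw [convex_iff_forall_pos]
    rintro x hx y hy p q hp hq hpq
    have e : l (p • x + q • y) = p * l x + q * l y := by simp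
    have et : l t = p * l t + q * l t := by rw [← add_mul, hpq, one_mul]
    rcases hx with hx | rfl
    · left
      have hy' : l t ≤ l y := hy.elim le_of_lt fun h => (congrArg l h).ge
      rw [e]
      nlinarith
    · rcases hy with hy | rfl
      · left
        rw [e]
        nlinarith
      · right
        rw [← add_smul, hpq, one_smul]
  refine convexHull_min (fun x hx => ?_) hconv hx
  by_cases hxt : x = t
  · exact Or.inr hxt
  · exact Or.inl (h x hx hxt)

end Convex

/-- If a linear map `φ` sends `P` into itself, fixes the exposed point `t`, and the points of `P`
over `t` are those of the segment from `t` to `s`, then this segment is an edge of `P`: it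
is exposed by the composition of `φ` with a functional exposing `t`. -/
theorem adjacent_of_retraction {ι : Type*} {P : Set (ι → ℝ)} (hP : Convex ℝ P) {t s : ι → ℝ}
    (ht : t ∈ P.exposedPoints ℝ) (hs : s ∈ P) (hts : t ≠ s)
    (φ : (ι → ℝ) →L[ℝ] (ι → ℝ)) (hφ : Set.MapsTo φ P P) (hφt : φ t = t) (hφs : φ s = t)
    (hfib : ∀ x ∈ P, φ x = t → x ∈ segment ℝ t s) : Adjacent P t s := by
  obtain ⟨htP, l, hl⟩ := ht
  have hexp : IsExposed ℝ P (segment ℝ t s) := by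
    refine fun _ => ⟨l.comp φ, Set.Subset.antisymm ?_ ?_⟩
    · intro x hx
      refine ⟨hP.segment_subset htP hs hx, fun y hy => ?_⟩
      have hx' : φ x = t := by
        obtain ⟨p, q, -, -, hpq, rfl⟩ := hx
        rw [map_add, map_smul, map_smul, hφt, hφs, ← add_smul, hpq, one_smul]
      simpa [hx'] using (hl _ (hφ hy)).1
    · rintro x ⟨hx, hmax⟩
      refine hfib x hx ((hl _ (hφ hx)).2 ?_)
      simpa [hφt] using hmax t htP
  have hvert := hexp.isExtreme.extremePoints_subset_extremePoints
  refine ⟨hvert ?_, hvert (right_mem_extremePoints_segment hts), hts, hexp⟩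
  rw [segment_symm]
  exact right_mem_extremePoints_segment hts.symm

/-! ### Solutions and vertices -/

section Solutions

variable {G : Type*} [AddCommGroup G]

theorem toReal_injective : Function.Injective (toReal (G := G)) := fun _ _ h =>
  funext fun g => Nat.cast_injective (congrFun h g)

theorem toReal_add (x y : GPlus G → ℕ) : toReal (x + y) = toReal x + toReal y := by
  ext g
  simp [toReal]

theorem toReal_nsmul (k : ℕ) (x : GPlus G → ℕ) : toReal (k • x) = (k : ℝ) • toReal x := by
  ext g
  simp [toReal]

variable [DecidableEq G]

/-- The linear map that replaces every occurrence of `w` by a copy of the block `a`. -/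
def expand (a : GPlus G → ℕ) (w : GPlus G) : (GPlus G → ℝ) →L[ℝ] (GPlus G → ℝ) :=
  ContinuousLinearMap.id ℝ _ +
    (ContinuousLinearMap.proj w).smulRight (toReal a - toReal (Pi.single w 1))

theorem expand_apply (a : GPlus G → ℕ) (w : GPlus G) (x : GPlus G → ℝ) :
    expand a w x = x + x w • (toReal a - toReal (Pi.single w 1)) := rfl

variable [Fintype G] {g₀ : G}

theorem toReal_mem_polyhedron {x : GPlus G → ℕ} (hx : x ∈ solutions g₀) :
    toReal x ∈ polyhedron g₀ :=
  subset_convexHull ℝ _ ⟨x, hx, rfl⟩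

theorem mem_solutions_of_extreme {t : GPlus G → ℕ}
    (ht : toReal t ∈ (polyhedron g₀).extremePoints ℝ) : t ∈ solutions g₀ := by
  obtain ⟨x, hx, h⟩ := extremePoints_convexHull_subset ht
  exact toReal_injective h ▸ hx

theorem nonneg_of_mem_polyhedron {x : GPlus G → ℝ} (hx : x ∈ polyhedron g₀) : 0 ≤ x := by
  refine convexHull_min ?_ (convex_Ici (𝕜 := ℝ) (0 : GPlus G → ℝ)) hx
  rintro _ ⟨y, -, rfl⟩ g
  exact Nat.cast_nonneg _

theorem sum_add_smul (x y : GPlus G → ℕ) :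
    ∑ g, (x + y) g • (g : G) = ∑ g, x g • (g : G) + ∑ g, y g • (g : G) := by
  simp [add_smul, Finset.sum_add_distrib]

theorem sum_single_smul (w : GPlus G) (k : ℕ) :
    ∑ g, (Pi.single w k : GPlus G → ℕ) g • (g : G) = k • (w : G) := by
  rw [Finset.sum_eq_single w] <;> simp +contextual

theorem sum_nsmul_smul (k : ℕ) (x : GPlus G → ℕ) :
    ∑ g, (k • x) g • (g : G) = k • ∑ g, x g • (g : G) := by
  simp [Finset.smul_sum, mul_smul]

theorem toReal_sum_single (x : GPlus G → ℕ) :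
    toReal x = ∑ g, (x g : ℝ) • toReal (Pi.single g 1) := by
  ext i
  simp [toReal, Pi.single_apply, Finset.sum_apply]

/-- Every vertex of the master corner polyhedron is an exposed point of it. -/
theorem mem_exposedPoints_of_extreme {t : GPlus G → ℕ}
    (ht : toReal t ∈ (polyhedron g₀).extremePoints ℝ) :
    toReal t ∈ (polyhedron g₀).exposedPoints ℝ := by
  have htS := mem_solutions_of_extreme ht
  set M : Set (GPlus G → ℕ) := {x | Minimal (· ∈ solutions g₀) x}
  have hM : M.Finite :=
    WellQuasiOrderedLE.finite_of_isAntichain (setOfPred_minimal_antichain _)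
  set R : Set (GPlus G → ℕ) :=
    M \ {t} ∪ Set.range fun g => t + Pi.single g (Fintype.card G)
  have hcard : Fintype.card G ≠ 0 := Fintype.card_ne_zero
  have hR : R.Finite := (hM.subset Set.sdiff_subset).union (Set.finite_range _)
  have hRS : ∀ x ∈ R, x ∈ solutions g₀ ∧ x ≠ t := by
    rintro x (⟨hx, hxt⟩ | ⟨g, rfl⟩)
    · exact ⟨hx.1, hxt⟩
    · have hne : t + Pi.single g (Fintype.card G) ≠ t := by simp [hcard]
      refine ⟨⟨fun h => htS.1 ?_, ?_⟩, hne⟩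
      · exact (add_eq_zero.1 h).1
      · rw [sum_add_smul, sum_single_smul, htS.2, card_nsmul_eq_zero, add_zero]
  have htR : toReal t ∉ convexHull ℝ (toReal '' R) := by
    refine fun h => ((convex_convexHull ℝ _).mem_extremePoints_iff_mem_sdiff_convexHull_sdiff.1
      ht).2 (convexHull_mono ?_ h)
    rintro _ ⟨x, hx, rfl⟩
    exact ⟨toReal_mem_polyhedron (hRS x hx).1, toReal_injective.ne (hRS x hx).2⟩
  obtain ⟨l, u, hlt, hlu⟩ := geometric_hahn_banach_point_closed (convex_convexHull ℝ _)
    ((hR.image toReal).isClosed_convexHull (𝕜 := ℝ)) htR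
  have hl : ∀ x ∈ R, l (toReal t) < l (toReal x) := fun x hx =>
    hlt.trans (hlu _ (subset_convexHull ℝ _ ⟨x, hx, rfl⟩))
  have hpos : ∀ g : GPlus G, 0 < l (toReal (Pi.single g 1)) := by
    intro g
    have h := hl _ (Or.inr ⟨g, rfl⟩)
    have e : (Pi.single g (Fintype.card G) : GPlus G → ℕ) =
        Fintype.card G • Pi.single g 1 := by
      rw [← Pi.single_smul]
      simp
    simp only [e, toReal_add, toReal_nsmul, map_add, map_smul, smul_eq_mul,
      lt_add_iff_pos_right] at h
    exact pos_of_mul_pos_right h (Nat.cast_nonneg _)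
  have hmono : ∀ z : GPlus G → ℕ, z ≠ 0 → 0 < l (toReal z) := by
    intro z hz
    obtain ⟨g, hg⟩ := Function.ne_iff.1 hz
    rw [toReal_sum_single, map_sum]
    refine Finset.sum_pos' (fun i _ => ?_) ⟨g, Finset.mem_univ g, ?_⟩
    · rw [map_smul]
      exact mul_nonneg (Nat.cast_nonneg _) (hpos i).le
    · rw [map_smul]
      exact mul_pos (Nat.cast_pos.2 (Nat.pos_of_ne_zero hg)) (hpos g)
  have hS : ∀ x ∈ toReal '' solutions g₀, x ≠ toReal t → l (toReal t) < l x := by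
    rintro _ ⟨x, hx, rfl⟩ hne
    obtain ⟨m, hmx, hm⟩ := exists_minimal_le_of_wellFoundedLT (· ∈ solutions g₀) x hx
    obtain ⟨z, rfl⟩ := exists_add_of_le hmx
    rw [toReal_add, map_add]
    have hml : l (toReal t) ≤ l (toReal m) := by
      by_cases hmt : m = t
      · rw [hmt]
      · exact (hl m (Or.inl ⟨hm, hmt⟩)).le
    by_cases hz : z = 0
    · subst hz
      rw [add_zero] at hne
      have h := hl m (Or.inl ⟨hm, fun h => hne (congrArg toReal h)⟩)
      have h0 : toReal (0 : GPlus G → ℕ) = 0 := by ext; simp [toReal]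
      simpa [h0] using h
    · linarith [hmono z hz]
  -- Exposed points are defined by maximizers, hence the sign.
  refine ⟨ht.1, -l, fun y hy => ?_⟩
  rcases lt_or_eq_of_mem_convexHull l hS hy with h | rfl
  · exact ⟨neg_le_neg h.le, fun h' => absurd (neg_le_neg_iff.1 h') (not_le.2 h)⟩
  · exact ⟨le_rfl, fun _ => rfl⟩

/-- If a vertex contains a block `a` with sum `w`, other than `w` itself, then it does not contain
`w`: exchanging the two in either direction would give solutions with the vertex as midpoint. -/
theorem apply_eq_zero_of_extreme {t a : GPlus G → ℕ} {w : GPlus G}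
    (ht : toReal t ∈ (polyhedron g₀).extremePoints ℝ) (hat : a ≤ t)
    (ha : ∑ g, a g • (g : G) = w) (haw : a ≠ Pi.single w 1) : t w = 0 := by
  by_contra hw
  have htS := mem_solutions_of_extreme ht
  obtain ⟨u, hu⟩ := exists_add_of_le hat
  have hwt : Pi.single w 1 ≤ t := by
    intro g
    by_cases hg : g = w
    · subst hg
      simpa [Nat.one_le_iff_ne_zero] using hw
    · simp [hg]
  obtain ⟨v, hv⟩ := exists_add_of_le hwt
  have ha0 : a ≠ 0 := by
    rintro rfl
    exact w.2 (by simpa using ha.symm)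
  have hu' : ∑ g, (Pi.single w 1 + u : GPlus G → ℕ) g • (g : G) = g₀ := by
    rw [sum_add_smul, sum_single_smul, one_smul, ← ha, ← sum_add_smul, ← hu, htS.2]
  have hv' : ∑ g, (a + v) g • (g : G) = g₀ := by
    rw [sum_add_smul, ha, ← one_smul ℕ (w : G), ← sum_single_smul, ← sum_add_smul, ← hv, htS.2]
  have hus : Pi.single w 1 + u ∈ solutions g₀ :=
    ⟨fun h => by simpa using (add_eq_zero.1 h).1, hu'⟩
  have hvs : a + v ∈ solutions g₀ := ⟨fun h => ha0 (add_eq_zero.1 h).1, hv'⟩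
  have hmid : toReal t ∈ openSegment ℝ (toReal (Pi.single w 1 + u)) (toReal (a + v)) := by
    refine ⟨1 / 2, 1 / 2, by norm_num, by norm_num, by norm_num, ?_⟩
    have h1 : toReal t = toReal a + toReal u := by rw [← toReal_add, ← hu]
    have h2 : toReal t = toReal (Pi.single w 1) + toReal v := by rw [← toReal_add, ← hv]
    rw [toReal_add, toReal_add]
    calc _ = (1 / 2 : ℝ) • (toReal a + toReal u) +
          (1 / 2 : ℝ) • (toReal (Pi.single w 1) + toReal v) := by module
      _ = toReal t := by rw [← h1, ← h2]; module
  have h := (mem_extremePoints_iff_left.1 ht).2 _ (toReal_mem_polyhedron hus) _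
    (toReal_mem_polyhedron hvs) hmid
  have h' : Pi.single w 1 + u = a + u := (toReal_injective h).trans hu
  exact haw (add_right_cancel h').symm

/-! ### Exchanging a block for its sum -/

theorem expand_mapsTo {a : GPlus G → ℕ} {w : GPlus G} (ha : ∑ g, a g • (g : G) = w) :
    Set.MapsTo (expand a w) (polyhedron g₀) (polyhedron g₀) := by
  suffices h : polyhedron g₀ ⊆ expand a w ⁻¹' polyhedron g₀ from h
  refine convexHull_min ?_ ((convex_convexHull ℝ _).is_linear_preimage (expand a w).isLinear)
  rintro _ ⟨x, hx, rfl⟩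
  have hwx : Pi.single w (x w) ≤ x := by
    intro g
    by_cases hg : g = w
    · subst hg
      simp
    · simp [hg]
  obtain ⟨u, hu⟩ := exists_add_of_le hwx
  have hsingle : (Pi.single w (x w) : GPlus G → ℕ) = x w • Pi.single w 1 := by
    rw [← Pi.single_smul]
    simp
  have hexp : expand a w (toReal x) = toReal (x w • a + u) := by
    have h1 : toReal x = (x w : ℝ) • toReal (Pi.single w 1) + toReal u := by
      rw [← toReal_nsmul, ← hsingle, ← toReal_add, ← hu]
    have h2 : toReal x w = (x w : ℝ) := rfl
    rw [expand_apply, h2, h1, toReal_add, toReal_nsmul]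
    module
  have hsum : ∑ g, (x w • a + u) g • (g : G) = g₀ := by
    rw [sum_add_smul, sum_nsmul_smul, ha, ← sum_single_smul, ← sum_add_smul, ← hu, hx.2]
  rw [Set.mem_preimage, hexp]
  refine toReal_mem_polyhedron ⟨fun h => hx.1 ?_, hsum⟩
  obtain ⟨h1, h2⟩ := add_eq_zero.1 h
  have ha0 : a ≠ 0 := by
    rintro rfl
    exact w.2 (by simpa using ha.symm)
  have hxw : x w = 0 := (smul_eq_zero.1 h1).resolve_right ha0
  rw [hu, h2, hxw]
  simp

/-- Exchanging copies of a block `a` in a vertex for copies of its sum `w`, as often as the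
coordinate `h` permits, leads to an adjacent vertex. -/
theorem adjacent_of_exchange {t s a : GPlus G → ℕ} {w h : GPlus G} {k : ℕ}
    (ht : toReal t ∈ (polyhedron g₀).extremePoints ℝ) (ha : ∑ g, a g • (g : G) = w)
    (haw : a ≠ Pi.single w 1) (hat : a ≤ t) (hk : 0 < k) (hah : 0 < a h)
    (hth : t h = k * a h) (hs : s + k • a = t + k • Pi.single w 1) :
    Adjacent (polyhedron g₀) (toReal t) (toReal s) := by
  have htS := mem_solutions_of_extreme ht
  have htw := apply_eq_zero_of_extreme ht hat ha haw
  have haw0 : a w = 0 := Nat.eq_zero_of_le_zero (htw ▸ hat w)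
  have hsw : s w = k := by simpa [haw0, htw] using congrFun hs w
  have hsS : s ∈ solutions g₀ := by
    refine ⟨fun h0 => by simp [h0] at hsw; omega, ?_⟩
    have e := congrArg (fun x : GPlus G → ℕ => ∑ g, x g • (g : G)) hs
    simp only [sum_add_smul, sum_nsmul_smul, sum_single_smul, ha, htS.2, one_smul] at e
    exact add_right_cancel e
  have hsR : toReal s + (k : ℝ) • toReal a =
      toReal t + (k : ℝ) • toReal (Pi.single w 1) := by
    rw [← toReal_nsmul, ← toReal_nsmul, ← toReal_add, ← toReal_add, hs]
  have hsR' := eq_sub_of_add_eq hsR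
  have hk' : (0 : ℝ) < k := Nat.cast_pos.2 hk
  refine adjacent_of_retraction (convex_convexHull ℝ _) (mem_exposedPoints_of_extreme ht)
    (toReal_mem_polyhedron hsS) (fun e => ?_) (expand a w) (expand_mapsTo ha) ?_ ?_ ?_
  · have := congrFun (toReal_injective e) w
    omega
  · have h2 : toReal t w = 0 := by simp [toReal, htw]
    rw [expand_apply, h2, zero_smul, add_zero]
  · have h2 : toReal s w = k := by simp [toReal, hsw]
    rw [expand_apply, h2, hsR']
    module
  · intro x hx hxt
    rw [expand_apply] at hxt
    have hxw : 0 ≤ x w := nonneg_of_mem_polyhedron hx w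
    -- The coordinate `h` of `x = t - x(w) (a - e_w)` is nonnegative, so `x(w)` is at most `k`.
    have hxk : x w ≤ k := by
      have h1 := congrFun hxt h
      have h2 : 0 ≤ x h := nonneg_of_mem_polyhedron hx h
      have hhw : h ≠ w := by
        rintro rfl
        omega
      have hah' : (0 : ℝ) < a h := Nat.cast_pos.2 hah
      simp only [toReal, Pi.add_apply, Pi.smul_apply, Pi.sub_apply, smul_eq_mul, hth,
        Pi.single_eq_of_ne hhw, Nat.cast_mul, Nat.cast_zero, sub_zero] at h1
      refine le_of_mul_le_mul_right ?_ hah'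
      linarith
    rw [segment_eq_image']
    refine ⟨x w / k, ⟨by positivity, (div_le_one hk').2 hxk⟩, ?_⟩
    have e : toReal s - toReal t = (k : ℝ) • (toReal (Pi.single w 1) - toReal a) := by
      rw [hsR']
      module
    simp only [e, smul_smul, div_mul_cancel₀ _ hk'.ne']
    rw [← hxt]
    module

end Solutions

end MasterCorner

theorem theorem3 {G : Type*} [AddCommGroup G] [Fintype G] [DecidableEq G] (g₀ : G)
    (t : MasterCorner.GPlus G → ℕ)
    (ht : MasterCorner.toReal t ∈ (MasterCorner.polyhedron g₀).extremePoints ℝ) :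
    (∀ h f : MasterCorner.GPlus G, MasterCorner.MuPairApplies t h f →
      MasterCorner.toReal (MasterCorner.muPair h f t) ∈
          (MasterCorner.polyhedron g₀).extremePoints ℝ ∧
        MasterCorner.Adjacent (MasterCorner.polyhedron g₀) (MasterCorner.toReal t)
          (MasterCorner.toReal (MasterCorner.muPair h f t))) ∧
    (∀ h : MasterCorner.GPlus G, MasterCorner.MuSingleApplies t h →
      MasterCorner.toReal (MasterCorner.muSingle h t) ∈
          (MasterCorner.polyhedron g₀).extremePoints ℝ ∧
        MasterCorner.Adjacent (MasterCorner.polyhedron g₀) (MasterCorner.toReal t)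
          (MasterCorner.toReal (MasterCorner.muSingle h t))) := by
  constructor
  · rintro h f ⟨hh, hf, hhf, hle, hne⟩
    let w : MasterCorner.GPlus G := ⟨h + f, hne⟩
    have hhw : h ≠ w := fun e => f.2 (by simpa [w] using congrArg Subtype.val e)
    have hfw : f ≠ w := fun e => h.2 (by simpa [w] using congrArg Subtype.val e)
    have key := MasterCorner.adjacent_of_exchange (s := MasterCorner.muPair h f t)
      (a := Pi.single h 1 + Pi.single f 1) (w := w) (h := h) (k := t h) ht
      (by simp [MasterCorner.sum_add_smul, -Pi.add_apply, w])
      (fun e => by simpa [hhw, hhf] using congrFun e h)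
      (fun g => by
        by_cases h1 : g = h
        · subst h1
          simpa [hhf] using Nat.one_le_of_lt hh
        · by_cases h2 : g = f
          · subst h2
            simpa [h1] using Nat.one_le_of_lt hf
          · simp [h1, h2])
      hh (by simp) (by simp [hhf])
      (by
        ext g
        have hgw : (g : G) = h + f ↔ g = w :=
          (Subtype.ext_iff (a1 := g) (a2 := w)).symm
        simp only [MasterCorner.muPair, hgw, Pi.add_apply, Pi.smul_apply, smul_eq_mul]
        by_cases h1 : g = h
        · subst h1
          simp [hhf, hhw]
        · by_cases h2 : g = f
          · subst h2
            simp [h1, hfw, hle]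
          · by_cases h3 : g = w
            · simp [h3, hhw.symm, hfw.symm]
            · simp [h1, h2, h3])
    exact ⟨key.2.1, key⟩
  · rintro h ⟨hh, hne⟩
    let w : MasterCorner.GPlus G := ⟨t h • (h : G), hne⟩
    have hsum : ∑ g, (Pi.single h (t h) : MasterCorner.GPlus G → ℕ) g • (g : G) = w :=
      MasterCorner.sum_single_smul h (t h)
    have hle : Pi.single h (t h) ≤ t := fun g => by
      by_cases h1 : g = h
      · subst h1
        simp
      · simp [h1]
    have hsingle : (Pi.single h (t h) : MasterCorner.GPlus G → ℕ) ≠ Pi.single w 1 := by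
      intro e
      have e' := congrFun e h
      rw [Pi.single_eq_same, Pi.single_apply] at e'
      split_ifs at e' <;> omega
    have htw := MasterCorner.apply_eq_zero_of_extreme ht hle hsum hsingle
    -- If `t(h) h` were `h`, then `t(h)` would vanish.
    have hhw : h ≠ w := fun e => by
      rw [← e] at htw
      omega
    have key := MasterCorner.adjacent_of_exchange (s := MasterCorner.muSingle h t)
      (w := w) (h := h) (k := 1) ht hsum hsingle hle one_pos (by simpa using by omega) (by simp)
      (by
        ext g
        have hgw : (g : G) = t h • (h : G) ↔ g = w :=
          (Subtype.ext_iff (a1 := g) (a2 := w)).symm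
        simp only [MasterCorner.muSingle, hgw, Pi.add_apply, one_smul]
        by_cases h1 : g = h
        · subst h1
          simp [hhw]
        · by_cases h3 : g = w
          · simp [h3, hhw.symm]
          · simp [h1, h3])
    exact ⟨key.2.1, key⟩
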